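/- For a finite simple graph $G$ on $n$ vertices with Laplacian eigenvalues $\mu_1\ge\dots\ge\mu_n$ and average degree $\overline d$, the Laplacian energy is $LE(G)=\sum_{i=1}^n|\mu_i-\overline d|$. Let $\mathcal S_{n,k}$ be the family of $n$-vertex trees consisting of a central vertex $u$ that is adjacent to one end of each of $h\ge 3$ disjoint paths with $a_1,\dots,a_h\ge 1$ vertices, where $a_i$ is even for $1\le i\le h-1$, $a_1=a_2=k\ge 2$, and $a_h<n/2$ is odd. Let $G\in\mathcal S_{n,k}$. Then $G$ can be obtained from two disjoint copies of the path $P_k$, whose vertices are labeled $1,\dots,k$ in increasing order along the path, and an $(n-2k)$-vertex graph $\breve G$ rooted at the central vertex $u$, by joining $u$ to the two copies of vertex $k$. For every such decomposition of $G$, let $\mathcal E_{e_1}(G)$ be the graph obtained from $G$ by adding the edge that joins the two copies of vertex $1$ of $P_k$. Then $$LE(G)=LE(\mathcal E_{e_1}(G)).$$ -/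

import Mathlib

/-- The average degree of a finite graph (`0` if there are no vertices). -/
noncomputable def averageDegree {V : Type*} [Fintype V] (G : SimpleGraph V) : ℝ :=
  open Classical in (∑ v : V, (G.degree v : ℝ)) / (Fintype.card V : ℝ)

/-- The eigenvalues of the Laplacian matrix `L = D - A` of `G`, listed with multiplicity. -/
noncomputable def lapEigenvalues {V : Type*} [Fintype V] (G : SimpleGraph V) : V → ℝ :=
  open Classical in (G.posSemidef_lapMatrix ℝ).isHermitian.eigenvalues

/-- The Laplacian energy: the sum over all Laplacian eigenvalues `μ` of `|μ - d|`, with `d` the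
average degree. -/
noncomputable def laplacianEnergy {V : Type*} [Fintype V] (G : SimpleGraph V) : ℝ :=
  ∑ i : V, |lapEigenvalues G i - averageDegree G|

/-- The graph `G(G*, Ğ, y)`: two disjoint copies of `G*` (first and second summand of the vertex
type) and one copy of `Ğ` (third summand), with the root `u` of `Ğ` joined to both copies of the
vertex `i` of `G*` if and only if `y i = 1`. -/
def twoCopyGraph {k : ℕ} {B : Type*} (Gstar : SimpleGraph (Fin k)) (Gbreve : SimpleGraph B)
    (u : B) (y : Fin k → Fin 2) : SimpleGraph (Fin k ⊕ Fin k ⊕ B) :=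
  SimpleGraph.fromRel fun p q =>
    match p, q with
    | .inl i, .inl j => Gstar.Adj i j
    | .inr (.inl i), .inr (.inl j) => Gstar.Adj i j
    | .inr (.inr b), .inr (.inr c) => Gbreve.Adj b c
    | .inr (.inr b), .inl i => b = u ∧ y i = 1
    | .inr (.inr b), .inr (.inl i) => b = u ∧ y i = 1
    | _, _ => False

/-- The edges joining the two copies of vertex `i` for each `i` with `z i = 1`. -/
def copyEdges {k : ℕ} (B : Type*) (z : Fin k → Fin 2) : SimpleGraph (Fin k ⊕ Fin k ⊕ B) :=
  SimpleGraph.fromRel fun p q =>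
    match p, q with
    | .inl i, .inr (.inl j) => i = j ∧ z i = 1
    | _, _ => False

/-- A way to view the graph `G` as a member `G(G*, Ğ, y)` of the family `W_{n,k}`. The existence of
the root forces `2 * k < n`. -/
structure WDecomposition (n k : ℕ) {V : Type*} (G : SimpleGraph V) where
  k_pos : 0 < k
  Gstar : SimpleGraph (Fin k)
  Gbreve : SimpleGraph (Fin (n - 2 * k))
  root : Fin (n - 2 * k)
  y : Fin k → Fin 2
  iso : twoCopyGraph Gstar Gbreve root y ≃g G

/-- The operation `E_z`: for every `i` with `z i = 1`, insert into `G` the edge between the two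
copies of the vertex `i` of `G*`. -/
def WDecomposition.opE {n k : ℕ} {V : Type*} {G : SimpleGraph V} (d : WDecomposition n k G)
    (z : Fin k → Fin 2) : SimpleGraph V :=
  G ⊔ (copyEdges (Fin (n - 2 * k)) z).map d.iso.toEquiv.toEmbedding

/-- The canonical vector `e_j` of `{0,1}^k`, where `j` runs from `1` to `k`. -/
def canonicalVector (k j : ℕ) : Fin k → Fin 2 :=
  fun i => if (i : ℕ) + 1 = j then 1 else 0

/-- The tree with a central vertex `none` that is adjacent to one end of each of `h` disjoint paths,
the `i`-th of which has the `a i` vertices `some ⟨i, 0⟩, some ⟨i, 1⟩, …`, in this order. -/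
def starlikeTree {h : ℕ} (a : Fin h → ℕ) : SimpleGraph (Option (Σ i : Fin h, Fin (a i))) :=
  SimpleGraph.fromRel fun p q =>
    match p, q with
    | none, some ⟨_, j⟩ => (j : ℕ) = 0
    | some ⟨i, j⟩, some ⟨i', j'⟩ => i = i' ∧ (j : ℕ) + 1 = (j' : ℕ)
    | _, _ => False

/-- The family `S_{n,k}`: `n`-vertex starlike trees with `h ≥ 3` branches of `a_1, …, a_h ≥ 1`
vertices (here indexed from `0`), where `a_1 = a_2 = k ≥ 2`, all of `a_1, …, a_{h-1}` are even, and
`a_h` is odd and less than `n / 2`. -/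
def MemS (n k : ℕ) {V : Type*} [Fintype V] (G : SimpleGraph V) : Prop :=
  Fintype.card V = n ∧ 2 ≤ k ∧
    ∃ (h : ℕ) (hh : 3 ≤ h) (a : Fin h → ℕ),
      (∀ i, 1 ≤ a i) ∧
      (∀ i : Fin h, (i : ℕ) < h - 1 → Even (a i)) ∧
      a ⟨0, by omega⟩ = k ∧ a ⟨1, by omega⟩ = k ∧
      Odd (a ⟨h - 1, by omega⟩) ∧ (a ⟨h - 1, by omega⟩ : ℝ) < (n : ℝ) / 2 ∧
      Nonempty (starlikeTree a ≃g G)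

/-- The decomposition of a member `G` of `S_{n,k}`: `G*` is the path `P_k` labeled in increasing
order along the path, `Ğ` is rooted at the central vertex of `G` (the one of degree larger than
two), and the adjacency vector is `e_k`. -/
def WDecomposition.IsStarlike {n k : ℕ} {V : Type*} {G : SimpleGraph V}
    (d : WDecomposition n k G) : Prop :=
  d.Gstar = SimpleGraph.pathGraph k ∧ d.y = canonicalVector k k ∧
    2 < (G.neighborSet (d.iso (.inr (.inr d.root)))).encard

/-! Exactly one branch is odd, so `n = 2N`: the tree has average degree `d = 2 - 1/N`, and one more
edge raises it to exactly 2. Both energies are shown to equal `∑ |μ - 2|` over the Laplacian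
spectrum of the tree.

For the new graph, on the two paths `L - 2` is minus the adjacency matrix, except for a diagonal
entry -1 at each free end, since all other path vertices have degree 2. Multiplying by the
permutation `P` that exchanges the paths moves these two entries to the place of the new edge, whose
ends now have degree 2. It also turns path edges into crossing edges, which are straightened by
exchanging the copies at every other level. So `L' - 2` is, after relabelling, `(L - 2) P`
(`lapMatrix_sup_copyEdges_sub_two`). As `P` commutes with `L` and `P² = 1`, the squares of `L' - 2`
and `L - 2` are similar, and the values `|μ - 2|` agree.

For the tree, `N` eigenvalues are at most `d` and the other `N` are at least 2, so `∑ |μ - x|` is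
constant on `[d, 2]` (`sum_abs_sub_eq_of_card_le`). Both counts come from `N`-dimensional test
spaces: a perfect matching gives the upper half, and weighted pairs along the branches give the
lower half (`branch_form_le`). -/

/-! ### Quadratic forms and eigenvalues of real symmetric matrices. -/

theorem Matrix.IsHermitian.dotProduct_mulVec_eq_sum {V : Type*} [Fintype V] [DecidableEq V]
    {A : Matrix V V ℝ} (hA : A.IsHermitian) (x : V → ℝ) :
    x ⬝ᵥ A.mulVec x = ∑ i, hA.eigenvalues i *
      ((star (hA.eigenvectorUnitary : Matrix V V ℝ)).mulVec x i) ^ 2 := by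
  set U : Matrix V V ℝ := hA.eigenvectorUnitary.val with hU
  have h := hA.spectral_theorem
  rw [Unitary.conjStarAlgAut_apply, ← hU] at h
  have h1 : A.mulVec x = U.mulVec
      ((Matrix.diagonal hA.eigenvalues).mulVec ((star U).mulVec x)) := by
    conv_lhs => rw [h]
    simp [Matrix.mulVec_mulVec, Matrix.mul_assoc]
  rw [h1, Matrix.dotProduct_mulVec, ← Matrix.mulVec_transpose]
  have h2 : U.transpose = star U := by
    rw [Matrix.star_eq_conjTranspose, Matrix.conjTranspose_eq_transpose_of_trivial]
  rw [h2]
  simp only [dotProduct, Matrix.mulVec_diagonal]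
  exact Finset.sum_congr rfl fun i _ => by ring

theorem Matrix.IsHermitian.dotProduct_self_eq_sum {V : Type*} [Fintype V] [DecidableEq V]
    {A : Matrix V V ℝ} (hA : A.IsHermitian) (x : V → ℝ) :
    x ⬝ᵥ x = ∑ i, ((star (hA.eigenvectorUnitary : Matrix V V ℝ)).mulVec x i) ^ 2 := by
  set U : Matrix V V ℝ := hA.eigenvectorUnitary.val with hU
  have h1 : x = U.mulVec ((star U).mulVec x) := by
    rw [Matrix.mulVec_mulVec, hU, Unitary.mul_star_self_of_mem hA.eigenvectorUnitary.2,
      Matrix.one_mulVec]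
  have h2 : U.transpose = star U := by
    rw [Matrix.star_eq_conjTranspose, Matrix.conjTranspose_eq_transpose_of_trivial]
  conv_lhs => enter [2]; rw [h1]
  rw [Matrix.dotProduct_mulVec, ← Matrix.mulVec_transpose, h2]
  simp only [dotProduct]
  exact Finset.sum_congr rfl fun i _ => by ring

/-- If the form `σ (xᵀ A x - c xᵀ x)` is nonpositive on a subspace, then the dimension of the
subspace is at most the number of eigenvalues `μ` with `σ (μ - c) ≤ 0`. -/
theorem Matrix.IsHermitian.card_le_card_eigenvalues {V ι : Type*} [Fintype V] [DecidableEq V]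
    [Fintype ι] {A : Matrix V V ℝ} (hA : A.IsHermitian) (σ c : ℝ)
    (T : (ι → ℝ) →ₗ[ℝ] (V → ℝ)) (hT : Function.Injective T)
    (hform : ∀ t, σ * (T t ⬝ᵥ A.mulVec (T t) - c * (T t ⬝ᵥ T t)) ≤ 0) :
    Fintype.card ι ≤ (Finset.univ.filter fun i => σ * (hA.eigenvalues i - c) ≤ 0).card := by
  classical
  set U : Matrix V V ℝ := hA.eigenvectorUnitary.val with hU
  let S := {i // σ * (hA.eigenvalues i - c) ≤ 0}
  let R : (ι → ℝ) →ₗ[ℝ] (S → ℝ) :=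
    (LinearMap.funLeft ℝ ℝ (Subtype.val : S → V)) ∘ₗ (star U).mulVecLin ∘ₗ T
  -- If the coordinates with `σ (μ - c) ≤ 0` all vanish, the form is a sum with positive
  -- coefficients on the remaining squares. Being nonpositive, it forces those coordinates to vanish
  -- too.
  have hR : Function.Injective R := by
    rw [← LinearMap.ker_eq_bot, LinearMap.ker_eq_bot']
    intro t ht
    have hz : ∀ i, σ * (hA.eigenvalues i - c) ≤ 0 → (star U).mulVec (T t) i = 0 := by
      intro i hi
      have := congrFun ht ⟨i, hi⟩
      simpa [R, LinearMap.funLeft_apply] using this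
    have hs : σ * (T t ⬝ᵥ A.mulVec (T t) - c * (T t ⬝ᵥ T t)) =
        ∑ i, σ * (hA.eigenvalues i - c) * ((star U).mulVec (T t) i) ^ 2 := by
      rw [hA.dotProduct_mulVec_eq_sum, hA.dotProduct_self_eq_sum, Finset.mul_sum,
        ← Finset.sum_sub_distrib, Finset.mul_sum]
      exact Finset.sum_congr rfl fun i _ => by rw [← hU]; ring
    have hnn : ∀ i ∈ Finset.univ,
        0 ≤ σ * (hA.eigenvalues i - c) * ((star U).mulVec (T t) i) ^ 2 := by
      intro i _
      by_cases hi : σ * (hA.eigenvalues i - c) ≤ 0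
      · rw [hz i hi]; simp
      · exact mul_nonneg (not_le.mp hi).le (sq_nonneg _)
    have h0 := le_antisymm (hs ▸ hform t) (Finset.sum_nonneg hnn)
    rw [Finset.sum_eq_zero_iff_of_nonneg hnn] at h0
    have hy : (star U).mulVec (T t) = 0 := by
      funext i
      by_cases hi : σ * (hA.eigenvalues i - c) ≤ 0
      · exact hz i hi
      · have := h0 i (Finset.mem_univ i)
        simpa [(not_le.mp hi).ne'] using this
    have hx : T t ⬝ᵥ T t = 0 := by
      rw [hA.dotProduct_self_eq_sum, ← hU, hy]
      simp
    rw [dotProduct_self_eq_zero] at hx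
    exact hT (by rw [hx, map_zero])
  have := LinearMap.finrank_le_finrank_of_injective hR
  simpa [S, Fintype.card_subtype] using this

/-- Since `|μ - c|` is the square root of `(μ - c)²`, the sum depends only on the characteristic
polynomial of `(A - c)²`. It can therefore be compared across matrices whose shifted squares are
similar, without matching eigenvalues. -/
theorem Matrix.IsHermitian.sum_abs_eigenvalues_sub {V : Type*} [Fintype V] [DecidableEq V]
    {A : Matrix V V ℝ} (hA : A.IsHermitian) (c : ℝ) :
    ∑ i, |hA.eigenvalues i - c| =
      ((((A - Matrix.scalar V c) * (A - Matrix.scalar V c)).charpoly.roots).map Real.sqrt).sum := by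
  have hcfc : (A - Matrix.scalar V c) * (A - Matrix.scalar V c) = cfc (fun x => (x - c) ^ 2) A := by
    have hsa : IsSelfAdjoint A := hA
    rw [cfc_pow (fun x => x - c) 2 A, cfc_sub (fun x => x) (fun _ => c) A, cfc_id' ℝ A,
      cfc_const c A, sq]
    rfl
  rw [hcfc, hA.charpoly_cfc_eq, Polynomial.roots_prod _ _
    (Finset.prod_ne_zero_iff.mpr fun i _ => Polynomial.X_sub_C_ne_zero _)]
  simp only [RCLike.ofReal_real_eq_id, id_eq, Polynomial.roots_X_sub_C, Multiset.map_bind,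
    Multiset.map_singleton, Real.sqrt_sq_eq_abs, Multiset.sum_bind, Multiset.sum_singleton]
  rfl

/-! ### Laplacian spectrum and average degree under isomorphism. -/

theorem sum_abs_lapEigenvalues_sub {V : Type*} [Fintype V] [DecidableEq V] (G : SimpleGraph V)
    [DecidableRel G.Adj] (c : ℝ) :
    ∑ i, |lapEigenvalues G i - c| =
      (((((G.lapMatrix ℝ - Matrix.scalar V c) * (G.lapMatrix ℝ - Matrix.scalar V c)).charpoly).roots
        ).map Real.sqrt).sum := by
  unfold lapEigenvalues
  rw [@Matrix.IsHermitian.sum_abs_eigenvalues_sub V _ (fun a b => Classical.propDecidable (a = b))]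
  congr!

theorem lapMatrix_apply_eq {V : Type*} [Fintype V] [DecidableEq V] (G : SimpleGraph V)
    [DecidableRel G.Adj] (p q : V) :
    G.lapMatrix ℝ p q = (if p = q then (G.degree p : ℝ) else 0) - if G.Adj p q then 1 else 0 := by
  simp [SimpleGraph.lapMatrix, SimpleGraph.degMatrix, Matrix.diagonal_apply,
    SimpleGraph.adjMatrix_apply]

theorem sum_abs_lapEigenvalues_sub_of_iso {V W : Type*} [Fintype V] [Fintype W]
    {G : SimpleGraph V} {H : SimpleGraph W} (e : G ≃g H) (c : ℝ) :
    ∑ i, |lapEigenvalues G i - c| = ∑ i, |lapEigenvalues H i - c| := by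
  classical
  rw [sum_abs_lapEigenvalues_sub, sum_abs_lapEigenvalues_sub]
  have h : Matrix.reindex e.toEquiv e.toEquiv (G.lapMatrix ℝ - Matrix.scalar V c) =
      H.lapMatrix ℝ - Matrix.scalar W c := by
    ext p q
    obtain ⟨p, rfl⟩ := e.surjective p
    obtain ⟨q, rfl⟩ := e.surjective q
    have hp : e.toEquiv.symm (e p) = p := e.toEquiv.symm_apply_apply p
    have hq : e.toEquiv.symm (e q) = q := e.toEquiv.symm_apply_apply q
    simp only [Matrix.reindex_apply, Matrix.submatrix_apply, Matrix.sub_apply, lapMatrix_apply_eq,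
      hp, hq, e.map_adj_iff, e.injective.eq_iff, Matrix.scalar_apply, Matrix.diagonal_apply,
      e.degree_eq]
  rw [← h, ← Matrix.charpoly_reindex e.toEquiv]
  simp only [Matrix.reindex_apply, Matrix.submatrix_mul_equiv]

theorem sum_degree_eq_of_iso {V W : Type*} [Fintype V] [Fintype W]
    {G : SimpleGraph V} {H : SimpleGraph W} [DecidableRel G.Adj] [DecidableRel H.Adj]
    (e : G ≃g H) : ∑ v, (G.degree v : ℝ) = ∑ v, (H.degree v : ℝ) :=
  Fintype.sum_equiv e.toEquiv _ _ fun v => by rw [← e.degree_eq v]; rfl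

theorem averageDegree_eq {V : Type*} [Fintype V] (G : SimpleGraph V) [DecidableRel G.Adj] :
    averageDegree G = (∑ v, (G.degree v : ℝ)) / Fintype.card V := by
  unfold averageDegree
  congr!

theorem averageDegree_eq_of_iso {V W : Type*} [Fintype V] [Fintype W]
    {G : SimpleGraph V} {H : SimpleGraph W} (e : G ≃g H) :
    averageDegree G = averageDegree H := by
  classical
  rw [averageDegree_eq, averageDegree_eq, sum_degree_eq_of_iso e, Fintype.card_congr e.toEquiv]

/-! ### Two-copy graphs and the inserted edge. -/

section TwoCopy

variable {k : ℕ} {B : Type*}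

/-- The involution of the vertex set that exchanges the two copies of every vertex in `s`. -/
def swapCopies (B : Type*) (s : Fin k → Prop) [DecidablePred s] :
    Fin k ⊕ Fin k ⊕ B → Fin k ⊕ Fin k ⊕ B
  | .inl i => if s i then .inr (.inl i) else .inl i
  | .inr (.inl i) => if s i then .inl i else .inr (.inl i)
  | .inr (.inr b) => .inr (.inr b)

theorem swapCopies_involutive (s : Fin k → Prop) [DecidablePred s] :
    Function.Involutive (swapCopies B s) := by
  rintro (i | i | b)
  · by_cases h : s i <;> simp [swapCopies, h]
  · by_cases h : s i <;> simp [swapCopies, h]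
  · rfl

variable (K : SimpleGraph (Fin k)) (T : SimpleGraph B) (u : B) (y z : Fin k → Fin 2)

theorem twoCopyGraph_adj_inl_inl (i j : Fin k) :
    (twoCopyGraph K T u y).Adj (.inl i) (.inl j) ↔ K.Adj i j := by
  simp only [twoCopyGraph, SimpleGraph.fromRel_adj, K.adj_comm j i, or_self, ne_eq, Sum.inl.injEq]
  exact ⟨fun h => h.2, fun h => ⟨h.ne, h⟩⟩

theorem twoCopyGraph_adj_snd_snd (i j : Fin k) :
    (twoCopyGraph K T u y).Adj (.inr (.inl i)) (.inr (.inl j)) ↔ K.Adj i j := by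
  simp only [twoCopyGraph, SimpleGraph.fromRel_adj, K.adj_comm j i, or_self, ne_eq, Sum.inr.injEq,
    Sum.inl.injEq]
  exact ⟨fun h => h.2, fun h => ⟨h.ne, h⟩⟩

theorem twoCopyGraph_adj_rest_rest (b c : B) :
    (twoCopyGraph K T u y).Adj (.inr (.inr b)) (.inr (.inr c)) ↔ T.Adj b c := by
  simp only [twoCopyGraph, SimpleGraph.fromRel_adj, T.adj_comm c b, or_self, ne_eq, Sum.inr.injEq]
  exact ⟨fun h => h.2, fun h => ⟨h.ne, h⟩⟩

theorem twoCopyGraph_adj_inl_snd (i j : Fin k) :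
    (twoCopyGraph K T u y).Adj (.inl i) (.inr (.inl j)) ↔ False := by
  simp [twoCopyGraph]

theorem twoCopyGraph_adj_snd_inl (i j : Fin k) :
    (twoCopyGraph K T u y).Adj (.inr (.inl i)) (.inl j) ↔ False := by
  simp [twoCopyGraph]

theorem twoCopyGraph_adj_inl_rest (i : Fin k) (b : B) :
    (twoCopyGraph K T u y).Adj (.inl i) (.inr (.inr b)) ↔ b = u ∧ y i = 1 := by
  simp [twoCopyGraph]

theorem twoCopyGraph_adj_snd_rest (i : Fin k) (b : B) :
    (twoCopyGraph K T u y).Adj (.inr (.inl i)) (.inr (.inr b)) ↔ b = u ∧ y i = 1 := by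
  simp [twoCopyGraph]

theorem twoCopyGraph_adj_rest_inl (i : Fin k) (b : B) :
    (twoCopyGraph K T u y).Adj (.inr (.inr b)) (.inl i) ↔ b = u ∧ y i = 1 := by
  simp [twoCopyGraph]

theorem twoCopyGraph_adj_rest_snd (i : Fin k) (b : B) :
    (twoCopyGraph K T u y).Adj (.inr (.inr b)) (.inr (.inl i)) ↔ b = u ∧ y i = 1 := by
  simp [twoCopyGraph]

theorem copyEdges_adj_inl_snd (i j : Fin k) :
    (copyEdges B z).Adj (.inl i) (.inr (.inl j)) ↔ i = j ∧ z i = 1 := by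
  simp [copyEdges]

theorem copyEdges_adj_snd_inl (i j : Fin k) :
    (copyEdges B z).Adj (.inr (.inl i)) (.inl j) ↔ j = i ∧ z j = 1 := by
  simp [copyEdges]

theorem not_copyEdges_adj_inl_inl (i j : Fin k) :
    ¬ (copyEdges B z).Adj (.inl i) (.inl j) := by
  simp [copyEdges]

theorem not_copyEdges_adj_snd_snd (i j : Fin k) :
    ¬ (copyEdges B z).Adj (.inr (.inl i)) (.inr (.inl j)) := by
  simp [copyEdges]

theorem not_copyEdges_adj_rest (p : Fin k ⊕ Fin k ⊕ B) (b : B) :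
    ¬ (copyEdges B z).Adj p (.inr (.inr b)) := by
  rcases p with i | i | c <;> simp [copyEdges]

theorem not_copyEdges_rest_adj (p : Fin k ⊕ Fin k ⊕ B) (b : B) :
    ¬ (copyEdges B z).Adj (.inr (.inr b)) p := by
  rcases p with i | i | c <;> simp [copyEdges]

end TwoCopy

theorem Fin.sum_ite_val_eq {k : ℕ} (m : ℕ) :
    ∑ j : Fin k, (if m = (j : ℕ) then (1 : ℝ) else 0) = if m < k then 1 else 0 := by
  by_cases h : m < k
  · have : ∀ j : Fin k, (m = (j : ℕ)) = ((⟨m, h⟩ : Fin k) = j) := fun j => by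
      rw [Fin.ext_iff]
    simp [this, h]
  · rw [if_neg h]
    exact Finset.sum_eq_zero fun j _ => if_neg (by omega)

theorem sum_pathGraph_adj {k : ℕ} (i : Fin k) [DecidableRel (SimpleGraph.pathGraph k).Adj] :
    ∑ j, (if (SimpleGraph.pathGraph k).Adj i j then (1 : ℝ) else 0) =
      2 - (if (i : ℕ) = 0 then 1 else 0) - (if (i : ℕ) + 1 = k then 1 else 0) := by
  have h1 : ∀ j : Fin k, (if (SimpleGraph.pathGraph k).Adj i j then (1 : ℝ) else 0) =
      (if (i : ℕ) + 1 = j then 1 else 0) + if (i : ℕ) = j + 1 then 1 else 0 := by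
    intro j
    simp only [SimpleGraph.pathGraph_adj]
    split_ifs <;> first | omega | norm_num
  have h2 : ∑ j : Fin k, (if (i : ℕ) = j + 1 then (1 : ℝ) else 0) =
      if (i : ℕ) = 0 then 0 else 1 := by
    have hi := i.2
    split_ifs with h
    · exact Finset.sum_eq_zero fun j _ => if_neg (by omega)
    · have : ∀ j : Fin k, (if (i : ℕ) = j + 1 then (1 : ℝ) else 0) =
          if (i : ℕ) - 1 = j then 1 else 0 := fun j => by congr 1; simp; omega
      simp only [this, Fin.sum_ite_val_eq]
      rw [if_pos (by omega)]
  have hi := i.2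
  simp only [h1, Finset.sum_add_distrib, Fin.sum_ite_val_eq, h2]
  split_ifs <;> first | omega | norm_num

section TwoCopy

variable {k : ℕ} {B : Type*} [Fintype B] (T : SimpleGraph B) (u : B)

theorem canonicalVector_eq_one_iff (k j : ℕ) (i : Fin k) :
    canonicalVector k j i = 1 ↔ (i : ℕ) + 1 = j := by
  simp [canonicalVector]

theorem degree_twoCopyGraph_inl (i : Fin k)
    [DecidableRel (twoCopyGraph (SimpleGraph.pathGraph k) T u (canonicalVector k k)).Adj] :
    ((twoCopyGraph (SimpleGraph.pathGraph k) T u (canonicalVector k k)).degree (.inl i) : ℝ) =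
      2 - if (i : ℕ) = 0 then 1 else 0 := by
  classical
  rw [SimpleGraph.degree_eq_sum_if_adj]
  simp only [Fintype.sum_sum_type, twoCopyGraph_adj_inl_inl, twoCopyGraph_adj_inl_snd,
    twoCopyGraph_adj_inl_rest, sum_pathGraph_adj, canonicalVector_eq_one_iff, ite_and]
  simp

theorem degree_twoCopyGraph_snd (i : Fin k)
    [DecidableRel (twoCopyGraph (SimpleGraph.pathGraph k) T u (canonicalVector k k)).Adj] :
    ((twoCopyGraph (SimpleGraph.pathGraph k) T u (canonicalVector k k)).degree (.inr (.inl i)) : ℝ) =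
      2 - if (i : ℕ) = 0 then 1 else 0 := by
  classical
  rw [SimpleGraph.degree_eq_sum_if_adj]
  simp only [Fintype.sum_sum_type, twoCopyGraph_adj_snd_inl, twoCopyGraph_adj_snd_snd,
    twoCopyGraph_adj_snd_rest, sum_pathGraph_adj, canonicalVector_eq_one_iff, ite_and]
  simp

variable (K : SimpleGraph (Fin k)) (y z : Fin k → Fin 2)

theorem degree_sup_copyEdges_inl (i : Fin k) [DecidableRel (twoCopyGraph K T u y).Adj]
    [DecidableRel (twoCopyGraph K T u y ⊔ copyEdges B z).Adj] :
    ((twoCopyGraph K T u y ⊔ copyEdges B z).degree (.inl i) : ℝ) =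
      (twoCopyGraph K T u y).degree (.inl i) + if z i = 1 then 1 else 0 := by
  classical
  rw [SimpleGraph.degree_eq_sum_if_adj, SimpleGraph.degree_eq_sum_if_adj]
  simp only [Fintype.sum_sum_type, SimpleGraph.sup_adj, twoCopyGraph_adj_inl_snd, false_or,
    copyEdges_adj_inl_snd, not_copyEdges_adj_inl_inl, not_copyEdges_adj_rest, or_false, ite_and]
  simp
  ring

theorem degree_sup_copyEdges_snd (i : Fin k) [DecidableRel (twoCopyGraph K T u y).Adj]
    [DecidableRel (twoCopyGraph K T u y ⊔ copyEdges B z).Adj] :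
    ((twoCopyGraph K T u y ⊔ copyEdges B z).degree (.inr (.inl i)) : ℝ) =
      (twoCopyGraph K T u y).degree (.inr (.inl i)) + if z i = 1 then 1 else 0 := by
  classical
  rw [SimpleGraph.degree_eq_sum_if_adj, SimpleGraph.degree_eq_sum_if_adj]
  simp only [Fintype.sum_sum_type, SimpleGraph.sup_adj, twoCopyGraph_adj_snd_inl, false_or,
    copyEdges_adj_snd_inl, not_copyEdges_adj_snd_snd, not_copyEdges_adj_rest, or_false, ite_and]
  simp
  ring

theorem degree_sup_copyEdges_rest (b : B) [DecidableRel (twoCopyGraph K T u y).Adj]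
    [DecidableRel (twoCopyGraph K T u y ⊔ copyEdges B z).Adj] :
    ((twoCopyGraph K T u y ⊔ copyEdges B z).degree (.inr (.inr b)) : ℝ) =
      (twoCopyGraph K T u y).degree (.inr (.inr b)) := by
  rw [SimpleGraph.degree_eq_sum_if_adj, SimpleGraph.degree_eq_sum_if_adj]
  simp only [SimpleGraph.sup_adj, not_copyEdges_rest_adj, or_false]

theorem sum_degree_sup_copyEdges [DecidableRel (twoCopyGraph K T u y).Adj]
    [DecidableRel (twoCopyGraph K T u y ⊔ copyEdges B z).Adj] :
    ∑ p, ((twoCopyGraph K T u y ⊔ copyEdges B z).degree p : ℝ) =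
      ∑ p, ((twoCopyGraph K T u y).degree p : ℝ) + 2 * ∑ i, if z i = 1 then 1 else 0 := by
  simp only [Fintype.sum_sum_type, degree_sup_copyEdges_inl, degree_sup_copyEdges_snd,
    degree_sup_copyEdges_rest, Finset.sum_add_distrib]
  ring

/-- Joining the two end vertices of the paths of a two-copy graph replaces the Laplacian `L` by a
matrix `L'` such that `L' - 2` is, up to relabelling, the product of `L - 2` with the permutation
matrix of the exchange of the two paths. -/
theorem lapMatrix_sup_copyEdges_sub_two [DecidableEq B]
    [DecidableRel (twoCopyGraph (SimpleGraph.pathGraph k) T u (canonicalVector k k)).Adj]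
    [DecidableRel (twoCopyGraph (SimpleGraph.pathGraph k) T u (canonicalVector k k) ⊔
      copyEdges B (canonicalVector k 1)).Adj] (p q : Fin k ⊕ Fin k ⊕ B) :
    ((twoCopyGraph (SimpleGraph.pathGraph k) T u (canonicalVector k k) ⊔
      copyEdges B (canonicalVector k 1)).lapMatrix ℝ - Matrix.scalar _ 2 :
        Matrix (Fin k ⊕ Fin k ⊕ B) (Fin k ⊕ Fin k ⊕ B) ℝ)
        (swapCopies B (fun i => (i : ℕ) % 2 = 1) p) (swapCopies B (fun i => (i : ℕ) % 2 = 1) q) =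
    ((twoCopyGraph (SimpleGraph.pathGraph k) T u (canonicalVector k k)).lapMatrix ℝ
      - Matrix.scalar _ 2 : Matrix (Fin k ⊕ Fin k ⊕ B) (Fin k ⊕ Fin k ⊕ B) ℝ)
        p (swapCopies B (fun _ => True) q) := by
  classical
  simp only [Matrix.sub_apply, Matrix.scalar_apply, Matrix.diagonal_apply]
  -- Adjacent path vertices have indices of opposite parity, so the relabelling exchanges exactly
  -- one of them, as does exchanging only the column index. At index 0, which is not relabelled, the
  -- inserted edge takes the place of the diagonal entry -1.
  rcases p with i | i | b <;> rcases q with j | j | c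
  all_goals
    try by_cases hi : (i : ℕ) % 2 = 1
    all_goals
      try by_cases hj : (j : ℕ) % 2 = 1
      all_goals
        simp only [swapCopies, *, if_true, if_false, lapMatrix_apply_eq,
          SimpleGraph.sup_adj,
          degree_sup_copyEdges_inl, degree_sup_copyEdges_snd, degree_sup_copyEdges_rest,
          degree_twoCopyGraph_inl, degree_twoCopyGraph_snd, twoCopyGraph_adj_inl_inl,
          twoCopyGraph_adj_inl_snd, twoCopyGraph_adj_inl_rest, twoCopyGraph_adj_snd_inl,
          twoCopyGraph_adj_snd_snd, twoCopyGraph_adj_snd_rest, twoCopyGraph_adj_rest_inl,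
          twoCopyGraph_adj_rest_snd, twoCopyGraph_adj_rest_rest, copyEdges_adj_inl_snd,
          copyEdges_adj_snd_inl, not_copyEdges_adj_inl_inl, not_copyEdges_adj_snd_snd,
          not_copyEdges_adj_rest, not_copyEdges_rest_adj, canonicalVector_eq_one_iff,
          SimpleGraph.pathGraph_adj, Sum.inl.injEq, Sum.inr.injEq, reduceCtorEq,
          or_false, false_or]
  all_goals
    try split_ifs
    all_goals first | omega | norm_num

theorem lapMatrix_twoCopyGraph_swapCopies [DecidableEq B] [DecidableRel (twoCopyGraph
      (SimpleGraph.pathGraph k) T u (canonicalVector k k)).Adj] (p q : Fin k ⊕ Fin k ⊕ B) :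
    (twoCopyGraph (SimpleGraph.pathGraph k) T u (canonicalVector k k)).lapMatrix ℝ
      (swapCopies B (fun _ => True) p) (swapCopies B (fun _ => True) q) =
    (twoCopyGraph (SimpleGraph.pathGraph k) T u (canonicalVector k k)).lapMatrix ℝ p q := by
  classical
  rcases p with i | i | b <;> rcases q with j | j | c <;>
    simp [swapCopies, lapMatrix_apply_eq, degree_twoCopyGraph_inl, degree_twoCopyGraph_snd,
      twoCopyGraph_adj_inl_inl, twoCopyGraph_adj_inl_snd, twoCopyGraph_adj_inl_rest,
      twoCopyGraph_adj_snd_inl, twoCopyGraph_adj_snd_snd, twoCopyGraph_adj_snd_rest,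
      twoCopyGraph_adj_rest_inl, twoCopyGraph_adj_rest_snd, twoCopyGraph_adj_rest_rest]

theorem sum_abs_lapEigenvalues_sub_two_sup_copyEdges :
    ∑ p, |lapEigenvalues (twoCopyGraph (SimpleGraph.pathGraph k) T u (canonicalVector k k) ⊔
      copyEdges B (canonicalVector k 1)) p - 2| =
    ∑ p, |lapEigenvalues (twoCopyGraph (SimpleGraph.pathGraph k) T u (canonicalVector k k)) p
      - 2| := by
  classical
  rw [sum_abs_lapEigenvalues_sub, sum_abs_lapEigenvalues_sub]
  let π : Equiv.Perm (Fin k ⊕ Fin k ⊕ B) := (swapCopies_involutive fun i => (i : ℕ) % 2 = 1).toPerm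
  let τ : Equiv.Perm (Fin k ⊕ Fin k ⊕ B) := (swapCopies_involutive fun _ => True).toPerm
  set M : Matrix (Fin k ⊕ Fin k ⊕ B) (Fin k ⊕ Fin k ⊕ B) ℝ :=
    (twoCopyGraph (SimpleGraph.pathGraph k) T u (canonicalVector k k) ⊔
      copyEdges B (canonicalVector k 1)).lapMatrix ℝ - Matrix.scalar _ 2 with hM
  set N : Matrix (Fin k ⊕ Fin k ⊕ B) (Fin k ⊕ Fin k ⊕ B) ℝ :=
    (twoCopyGraph (SimpleGraph.pathGraph k) T u (canonicalVector k k)).lapMatrix ℝ -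
      Matrix.scalar _ 2 with hN
  have h1 : M.submatrix π π = N.submatrix id τ := by
    ext p q
    exact lapMatrix_sup_copyEdges_sub_two T u p q
  have h2 : N.submatrix id τ = N.submatrix τ id := by
    ext p q
    obtain ⟨q, rfl⟩ := τ.surjective q
    have hq : τ (τ q) = q := swapCopies_involutive _ q
    simp only [Matrix.submatrix_apply, id, hq]
    simp only [hN, Matrix.sub_apply, Matrix.scalar_apply, Matrix.diagonal_apply, τ.injective.eq_iff]
    congr 1
    exact (lapMatrix_twoCopyGraph_swapCopies T u p q).symm
  have h3 : (M * M).submatrix π π = N * N := by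
    rw [← Matrix.submatrix_mul_equiv M M π π π, h1]
    -- With `τ` on the rows of the right factor, it cancels against `τ` on the columns of the left
    -- factor.
    conv_lhs => enter [2]; rw [h2]
    rw [Matrix.submatrix_mul_equiv]
    rfl
  rw [← h3, ← Matrix.charpoly_reindex π.symm]
  rfl

end TwoCopy

/-- The new edge adds 2 to the degree sum; by `h2` the average becomes 2, the one shift at which the
two spectra are compared. -/
theorem laplacianEnergy_opE {V : Type*} [Fintype V] {n k : ℕ} {G : SimpleGraph V}
    (d : WDecomposition n k G) (hGs : d.Gstar = SimpleGraph.pathGraph k)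
    (hy : d.y = canonicalVector k k)
    (h2 : averageDegree G + 2 / Fintype.card V = 2) :
    laplacianEnergy (d.opE (canonicalVector k 1)) =
      ∑ v, |lapEigenvalues G v - 2| := by
  classical
  have hadj : ∀ p q, (d.opE (canonicalVector k 1)).Adj (d.iso p) (d.iso q) ↔
      (twoCopyGraph d.Gstar d.Gbreve d.root d.y ⊔ copyEdges _ (canonicalVector k 1)).Adj p q := by
    intro p q
    rw [WDecomposition.opE, SimpleGraph.sup_adj, SimpleGraph.sup_adj, d.iso.map_adj_iff]
    exact or_congr Iff.rfl
      (SimpleGraph.map_adj_apply (f := d.iso.toEquiv.toEmbedding) (a := p) (b := q))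
  have e : (twoCopyGraph d.Gstar d.Gbreve d.root d.y ⊔ copyEdges _ (canonicalVector k 1)) ≃g
      d.opE (canonicalVector k 1) := ⟨d.iso.toEquiv, hadj _ _⟩
  have hk := d.k_pos
  have hz : ∑ i : Fin k, (if canonicalVector k 1 i = 1 then (1 : ℝ) else 0) = 1 := by
    simp only [canonicalVector_eq_one_iff]
    refine Eq.trans (Finset.sum_congr rfl fun i _ => ?_)
      ((Fin.sum_ite_val_eq (k := k) 0).trans (if_pos hk))
    congr 1
    simp [eq_comm]
  have hdeg : averageDegree (d.opE (canonicalVector k 1)) =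
      averageDegree G + 2 / Fintype.card V := by
    rw [averageDegree_eq, averageDegree_eq, ← sum_degree_eq_of_iso e, sum_degree_sup_copyEdges,
      sum_degree_eq_of_iso d.iso, hz, add_div, mul_one]
  rw [laplacianEnergy, hdeg, h2, ← sum_abs_lapEigenvalues_sub_of_iso e,
    ← sum_abs_lapEigenvalues_sub_of_iso d.iso, hGs, hy,
    sum_abs_lapEigenvalues_sub_two_sup_copyEdges]

/-! ### Counting Laplacian eigenvalues with test spaces. -/

theorem card_le_card_lapEigenvalues {V ι : Type*} [Fintype V] [Fintype ι] (G : SimpleGraph V)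
    [DecidableRel G.Adj] (σ c : ℝ) (T : (ι → ℝ) →ₗ[ℝ] (V → ℝ)) (hT : Function.Injective T)
    (hform : ∀ t, σ * ((∑ p, ∑ q, if G.Adj p q then (T t p - T t q) ^ 2 else 0) / 2 -
      c * ∑ p, T t p ^ 2) ≤ 0) :
    Fintype.card ι ≤ (Finset.univ.filter fun i => σ * (lapEigenvalues G i - c) ≤ 0).card := by
  classical
  refine @Matrix.IsHermitian.card_le_card_eigenvalues V ι _ (fun a b => Classical.propDecidable _) _
    _ _ σ c T hT fun t => ?_
  rw [← Matrix.toLinearMap₂'_apply', SimpleGraph.lapMatrix_toLinearMap₂']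
  have h2 : ∑ p, T t p ^ 2 = T t ⬝ᵥ T t := Finset.sum_congr rfl fun p _ => sq _
  rw [← h2]
  convert hform t using 5
  exact Finset.sum_congr rfl fun q _ => by congr

/-- The linear map that sends `t` to the vector with entries `s v * t (c v)`. -/
def weightedPullback {V ι : Type*} (c : V → ι) (s : V → ℝ) : (ι → ℝ) →ₗ[ℝ] (V → ℝ) where
  toFun t v := s v * t (c v)
  map_add' t t' := by ext v; simp [mul_add]
  map_smul' r t := by ext v; simp [mul_left_comm]

theorem weightedPullback_apply {V ι : Type*} (c : V → ι) (s : V → ℝ) (t : ι → ℝ) (v : V) :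
    weightedPullback c s t v = s v * t (c v) := rfl

theorem weightedPullback_injective {V ι : Type*} (c : V → ι) (s : V → ℝ) (r : ι → V)
    (hc : ∀ i, c (r i) = i) (hs : ∀ i, s (r i) ≠ 0) :
    Function.Injective (weightedPullback c s) := by
  intro t t' h
  ext i
  have := congrFun h (r i)
  rw [weightedPullback_apply, weightedPullback_apply, hc] at this
  exact mul_left_cancel₀ (hs i) this

/-- If every vertex `v` has a neighbour `m v`, then the Laplacian form is at least twice the square
of the norm on vectors that change sign under `m`. -/
theorem two_mul_sum_sq_le_of_neighbor {V : Type*} [Fintype V] (G : SimpleGraph V)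
    [DecidableRel G.Adj] (m : V → V) (hm : ∀ v, G.Adj v (m v)) (x : V → ℝ)
    (hx : ∀ v, x (m v) = -x v) :
    2 * ∑ p, x p ^ 2 ≤ (∑ p, ∑ q, if G.Adj p q then (x p - x q) ^ 2 else 0) / 2 := by
  rw [le_div_iff₀ two_pos, Finset.mul_sum, Finset.sum_mul]
  -- Among ordered pairs starting at `p`, the pair `(p, m p)` alone contributes `4 * x p ^ 2`, so
  -- `m` need not be an involution.
  refine Finset.sum_le_sum fun p _ => ?_
  have h := Finset.single_le_sum (f := fun q => if G.Adj p q then (x p - x q) ^ 2 else 0)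
    (fun q _ => by split_ifs <;> positivity) (Finset.mem_univ (m p))
  simp only [hm p, if_true, hx p] at h
  linarith

/-- The two index sets are disjoint, hence exhaust `V` with exactly `N` elements each. Between `a`
and `b`, `N` terms grow and `N` terms shrink at the same rate. -/
theorem sum_abs_sub_eq_of_card_le {V : Type*} [Fintype V] (μ : V → ℝ) {a b : ℝ} (N : ℕ)
    (hab : a < b) (hN : Fintype.card V = 2 * N)
    (ha : N ≤ (Finset.univ.filter fun i => μ i ≤ a).card)
    (hb : N ≤ (Finset.univ.filter fun i => b ≤ μ i).card) :
    ∑ i, |μ i - a| = ∑ i, |μ i - b| := by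
  classical
  set S := Finset.univ.filter fun i => μ i ≤ a
  set T := Finset.univ.filter fun i => b ≤ μ i
  have hd : Disjoint S T := by
    rw [Finset.disjoint_left]
    intro i hi hi'
    simp only [S, T, Finset.mem_filter, Finset.mem_univ, true_and] at hi hi'
    linarith
  have hu : S ∪ T = Finset.univ := by
    rw [← Finset.card_eq_iff_eq_univ]
    refine le_antisymm (Finset.card_le_univ _) ?_
    rw [Finset.card_union_of_disjoint hd]
    omega
  have hcard : S.card + T.card = 2 * N := by
    rw [← Finset.card_union_of_disjoint hd, hu, Finset.card_univ, hN]
  have hS : ∑ i ∈ S, (|μ i - a| - |μ i - b|) = S.card * (a - b) := by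
    rw [← nsmul_eq_mul, ← Finset.sum_const]
    refine Finset.sum_congr rfl fun i hi => ?_
    simp only [S, Finset.mem_filter, Finset.mem_univ, true_and] at hi
    rw [abs_of_nonpos (by linarith), abs_of_nonpos (by linarith)]
    ring
  have hT : ∑ i ∈ T, (|μ i - a| - |μ i - b|) = T.card * (b - a) := by
    rw [← nsmul_eq_mul, ← Finset.sum_const]
    refine Finset.sum_congr rfl fun i hi => ?_
    simp only [T, Finset.mem_filter, Finset.mem_univ, true_and] at hi
    rw [abs_of_nonneg (by linarith), abs_of_nonneg (by linarith)]
    ring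
  rw [← sub_eq_zero, ← Finset.sum_sub_distrib, ← hu, Finset.sum_union hd, hS, hT,
    show S.card = N by omega, show T.card = N by omega]
  ring

/-! ### The energy inequality along one branch. -/

/-- The term `(N - m) * N * t m ^ 2` is a debt left by the edge entering pair `m`, to be paid by the
norm of that pair. The weights `p = N - m`, `q = m + 1` satisfy `p + q = N + 1`, which makes the
debt reproduce itself from one pair to the next. -/
theorem branch_form_succ_le (N : ℕ) (t X : ℕ → ℝ) (h0 : X 0 = 0)
    (hodd : ∀ m, X (2 * m + 1) = (N - m) * t m) (heven : ∀ m, X (2 * m + 2) = (m + 1) * t m)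
    (hN : 0 < N) (m : ℕ) (hm : m ≤ N) :
    ∑ j ∈ Finset.range (2 * m + 1), (X j - X (j + 1)) ^ 2 ≤
      (2 - 1 / (N : ℝ)) * ∑ j ∈ Finset.range (2 * m), X (j + 1) ^ 2 + (N - m) * N * t m ^ 2 := by
  induction m with
  | zero =>
    have := hodd 0
    simp only [mul_zero, zero_add, CharP.cast_eq_zero, sub_zero] at this
    simp [h0, this]
    nlinarith
  | succ m ih =>
    have ih := ih (by omega)
    have hmN : (m : ℝ) + 1 ≤ N := by exact_mod_cast hm
    have hm0 : (0 : ℝ) ≤ m := m.cast_nonneg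
    have hN0 : (0 : ℝ) < N := by exact_mod_cast hN
    have h1 := hodd (m + 1)
    rw [show 2 * (m + 1) + 1 = 2 * m + 1 + 1 + 1 by ring] at h1 ⊢
    rw [show 2 * (m + 1) = 2 * m + 1 + 1 by ring]
    have h2 := heven m
    rw [show 2 * m + 2 = 2 * m + 1 + 1 by ring] at h2
    rw [Finset.sum_range_succ _ (2 * m + 1 + 1), Finset.sum_range_succ _ (2 * m + 1),
      Finset.sum_range_succ (fun j => X (j + 1) ^ 2) (2 * m + 1),
      Finset.sum_range_succ (fun j => X (j + 1) ^ 2) (2 * m), h1, h2, hodd m]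
    push_cast
    -- The coefficient of `t m ^ 2` to be paid is `2 (p² + q²) - (N + 1)`, so `p² + q² ≤ N (N + 1)`
    -- suffices; it follows from `p q = N + m (N - m - 1) ≥ N`.
    have key : ((N - m) ^ 2 + (m + 1) ^ 2) * (1 / (N : ℝ)) ≤ N + 1 := by
      rw [mul_one_div, div_le_iff₀ hN0]
      nlinarith [mul_nonneg hm0 (sub_nonneg.2 hmN)]
    -- Bounds the cross term of the edge between consecutive pairs. The coefficient of `t (m + 1) ^
    -- 2` becomes `(N - m - 1)² + (m + 1)(N - m - 1) = (N - m - 1) N`, the next debt.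
    have hs : 0 ≤ ((m : ℝ) + 1) * (N - m - 1) * (t m + t (m + 1)) ^ 2 := by
      have : (0 : ℝ) ≤ N - m - 1 := by linarith
      positivity
    have hk := mul_le_mul_of_nonneg_right key (sq_nonneg (t m))
    generalize 1 / (N : ℝ) = e at *
    linarith

theorem branch_form_le (N : ℕ) (t X : ℕ → ℝ) (h0 : X 0 = 0)
    (hodd : ∀ m, X (2 * m + 1) = (N - m) * t m) (heven : ∀ m, X (2 * m + 2) = (m + 1) * t m)
    (hN : 0 < N) (a : ℕ) (ha : a ≤ 2 * N) (hta : ∀ m, (a + 1) / 2 ≤ m → t m = 0)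
    (haN : Odd a → a < N) :
    ∑ j ∈ Finset.range a, (X j - X (j + 1)) ^ 2 ≤
      (2 - 1 / (N : ℝ)) * ∑ j ∈ Finset.range a, X (j + 1) ^ 2 := by
  have hN0 : (0 : ℝ) < N := by exact_mod_cast hN
  rcases Nat.even_or_odd' a with ⟨m, rfl | rfl⟩
  · have h := branch_form_succ_le N t X h0 hodd heven hN m (by omega)
    -- Past the end of an even branch `t m = 0`, so no debt remains.
    rw [hta m (by omega), Finset.sum_range_succ] at h
    nlinarith [sq_nonneg (X (2 * m) - X (2 * m + 1))]
  · have h := branch_form_succ_le N t X h0 hodd heven hN m (by omega)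
    have hlt := haN (odd_two_mul_add_one m)
    have hlt' : 2 * (m : ℝ) + 2 ≤ N := by exact_mod_cast hlt
    rw [Finset.sum_range_succ (fun j => X (j + 1) ^ 2), mul_add, hodd]
    -- On an odd branch the single last vertex, of weight `N - m`, pays the final debt; this is
    -- where the branch must be shorter than `N`.
    have key : (N : ℝ) ≤ (2 - 1 / (N : ℝ)) * (N - m) := by
      rw [show (2 - 1 / (N : ℝ)) * (N - m) = ((2 * N - 1) * (N - m)) / N by field_simp,
        le_div_iff₀ hN0]
      nlinarith [m.cast_nonneg (α := ℝ)]
    have hnn : 0 ≤ (N - m) * t m ^ 2 := mul_nonneg (by linarith) (sq_nonneg _)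
    nlinarith [mul_le_mul_of_nonneg_right key hnn]

/-! ### Starlike trees: edges, degree sum and the two halves of the spectrum. -/

section Starlike

variable {h : ℕ} (a : Fin h → ℕ)

/-- The neighbour of a vertex of a starlike tree on the path to the centre. -/
def starlikeParent (v : Σ i : Fin h, Fin (a i)) : Option (Σ i : Fin h, Fin (a i)) :=
  if (v.2 : ℕ) = 0 then none else some ⟨v.1, ⟨v.2 - 1, by omega⟩⟩

theorem starlikeTree_adj_none_some (v : Σ i : Fin h, Fin (a i)) :
    (starlikeTree a).Adj none (some v) ↔ (v.2 : ℕ) = 0 := by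
  simp [starlikeTree]

theorem starlikeTree_adj_some_some (v w : Σ i : Fin h, Fin (a i)) :
    (starlikeTree a).Adj (some v) (some w) ↔
      v.1 = w.1 ∧ ((v.2 : ℕ) + 1 = w.2 ∨ (w.2 : ℕ) + 1 = v.2) := by
  obtain ⟨i, j⟩ := v
  obtain ⟨i', j'⟩ := w
  simp only [starlikeTree, SimpleGraph.fromRel_adj, ne_eq, Option.some.injEq]
  constructor
  · rintro ⟨-, ⟨rfl, h⟩ | ⟨rfl, h⟩⟩
    · exact ⟨rfl, .inl h⟩
    · exact ⟨rfl, .inr h⟩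
  · rintro ⟨rfl, h⟩
    refine ⟨fun he => ?_, h.imp (⟨rfl, ·⟩) (⟨rfl, ·⟩)⟩
    simp only [Sigma.mk.injEq, heq_eq_eq, true_and] at he
    omega

theorem eq_starlikeParent_iff (p : Option (Σ i : Fin h, Fin (a i))) (v : Σ i : Fin h, Fin (a i)) :
    p = starlikeParent a v ↔ (p = none ∧ (v.2 : ℕ) = 0) ∨
      ∃ w, p = some w ∧ w.1 = v.1 ∧ (w.2 : ℕ) + 1 = v.2 := by
  obtain ⟨i, j⟩ := v
  unfold starlikeParent
  rcases p with _ | ⟨i', j'⟩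
  · split_ifs with h0 <;> simp_all
  · have hj := j.2
    split_ifs with h0
    · simp_all
    · have h0' : ¬ (j : ℕ) = 0 := h0
      simp only [Option.some.injEq, false_and, false_or, exists_eq_left']
      constructor
      · intro he
        obtain ⟨rfl, he⟩ := Sigma.mk.inj he
        simp only [heq_eq_eq, Fin.ext_iff] at he
        exact ⟨rfl, show (j' : ℕ) + 1 = j by omega⟩
      · rintro ⟨hi, he⟩
        obtain rfl : i' = i := hi
        have he' : (j' : ℕ) + 1 = j := he
        simp only [Sigma.mk.injEq, heq_eq_eq, true_and, Fin.ext_iff]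
        omega

theorem starlikeTree_adj_some_right (p : Option (Σ i : Fin h, Fin (a i)))
    (v : Σ i : Fin h, Fin (a i)) : (starlikeTree a).Adj p (some v) ↔
      p = starlikeParent a v ∨ ∃ w, p = some w ∧ some v = starlikeParent a w := by
  rcases p with _ | w
  · simp [starlikeTree_adj_none_some, eq_starlikeParent_iff]
  · simp [starlikeTree_adj_some_some, eq_starlikeParent_iff]
    tauto

/-- Every edge joins exactly one noncentral vertex to its parent, and is met once in each direction.
-/
theorem sum_starlikeTree_adj [DecidableRel (starlikeTree a).Adj]
    (f : Option (Σ i : Fin h, Fin (a i)) → Option (Σ i : Fin h, Fin (a i)) → ℝ)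
    (hf : ∀ p q, f p q = f q p) :
    ∑ p, ∑ q, (if (starlikeTree a).Adj p q then f p q else 0) =
      2 * ∑ v, f (starlikeParent a v) (some v) := by
  classical
  let C : Option (Σ i : Fin h, Fin (a i)) → Option (Σ i : Fin h, Fin (a i)) → Prop :=
    fun p q => ∃ v, q = some v ∧ p = starlikeParent a v
  have hadj : ∀ p q, (if (starlikeTree a).Adj p q then f p q else 0) =
      (if C p q then f p q else 0) + if C q p then f q p else 0 := by
    intro p q
    have h1 : (starlikeTree a).Adj p q ↔ C p q ∨ C q p := by
      rcases q with _ | v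
      · rcases p with _ | w
        · simp [C]
        · rw [SimpleGraph.adj_comm, starlikeTree_adj_some_right]
          simp [C, -Sigma.exists]
      · rw [starlikeTree_adj_some_right]
        simp [C, -Sigma.exists]
    have h2 : ¬ (C p q ∧ C q p) := by
      rintro ⟨⟨v, rfl, hv⟩, ⟨w, rfl, hw⟩⟩
      rw [eq_starlikeParent_iff] at hv hw
      simp at hv hw
      omega
    rw [hf q p]
    simp only [h1]
    by_cases hp : C p q <;> by_cases hq : C q p <;> simp_all
  have hC : ∑ q, ∑ p, (if C p q then f p q else 0) = ∑ v, f (starlikeParent a v) (some v) := by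
    rw [Fintype.sum_option]
    simp only [C, reduceCtorEq, false_and, exists_false, if_false, Finset.sum_const_zero, zero_add,
      Option.some.injEq, exists_eq_left', Finset.sum_ite_eq', Finset.mem_univ, if_true]
  simp only [hadj, Finset.sum_add_distrib]
  rw [hC, Finset.sum_comm, hC]
  ring

theorem sum_degree_starlikeTree [DecidableRel (starlikeTree a).Adj] :
    ∑ p, ((starlikeTree a).degree p : ℝ) = 2 * ∑ i, (a i : ℝ) := by
  simp only [SimpleGraph.degree_eq_sum_if_adj]
  rw [sum_starlikeTree_adj a (fun _ _ => 1) (fun _ _ => rfl)]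
  simp

theorem card_starlikeTree_vertices :
    Fintype.card (Option (Σ i : Fin h, Fin (a i))) = ∑ i, a i + 1 := by
  simp

variable {a} {l : Fin h} {N : ℕ}

/-- Only the odd branch is rounded up, and its surplus accounts for the centre. -/
theorem two_mul_sum_half (hl : Odd (a l)) (he : ∀ i, i ≠ l → Even (a i)) :
    2 * ∑ i, (a i + 1) / 2 = ∑ i, a i + 1 := by
  have h1 : ∀ i, 2 * ((a i + 1) / 2) = a i + if i = l then 1 else 0 := by
    intro i
    split_ifs with hi
    · subst hi; obtain ⟨m, hm⟩ := hl; omega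
    · obtain ⟨m, hm⟩ := he i hi; omega
  simp only [Finset.mul_sum, h1, Finset.sum_add_distrib]
  simp

theorem card_half_branches (hl : Odd (a l)) (he : ∀ i, i ≠ l → Even (a i))
    (hN : ∑ i, a i + 1 = 2 * N) :
    Fintype.card (Σ i : Fin h, Fin ((a i + 1) / 2)) = N := by
  have := two_mul_sum_half hl he
  simp only [Fintype.card_sigma, Fintype.card_fin]
  omega

/-- The test vectors vanish at the centre, which decouples the branches. Each branch is cut into
consecutive pairs from the centre outwards, with one free parameter per pair and one for the last
vertex of the odd branch. -/
theorem card_le_card_lapEigenvalues_starlikeTree_le (hl : Odd (a l))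
    (he : ∀ i, i ≠ l → Even (a i)) (hN : ∑ i, a i + 1 = 2 * N) (hlN : a l < N) :
    N ≤ (Finset.univ.filter fun p =>
      lapEigenvalues (starlikeTree a) p ≤ 2 - 1 / (N : ℝ)).card := by
  classical
  have hal : 0 < a l := hl.pos
  have haN : ∀ i, a i ≤ 2 * N := fun i => by
    have := Finset.single_le_sum (fun i _ => Nat.zero_le (a i)) (Finset.mem_univ i)
    omega
  -- The class of the centre is arbitrary, since its weight is 0.
  let c : Option (Σ i : Fin h, Fin (a i)) → Σ i : Fin h, Fin ((a i + 1) / 2)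
    | none => ⟨l, ⟨0, by omega⟩⟩
    | some v => ⟨v.1, ⟨v.2 / 2, by omega⟩⟩
  let w : ℕ → ℝ := fun j => if j % 2 = 0 then N - (j / 2 : ℕ) else (j / 2 : ℕ) + 1
  let s : Option (Σ i : Fin h, Fin (a i)) → ℝ
    | none => 0
    | some v => w v.2
  let r : (Σ i : Fin h, Fin ((a i + 1) / 2)) → Option (Σ i : Fin h, Fin (a i)) :=
    fun i => some ⟨i.1, ⟨2 * i.2, by omega⟩⟩
  have hinj : Function.Injective (weightedPullback c s) := by
    refine weightedPullback_injective c s r ?_ ?_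
    · rintro ⟨i, m⟩
      simp [c, r]
    · rintro ⟨i, m⟩
      have hm := m.2
      have := haN i
      have hlt : ((m : ℕ) : ℝ) < N := by exact_mod_cast (by omega : (m : ℕ) < N)
      simp only [s, r, w, Nat.mul_mod_right, if_true]
      rw [Nat.mul_div_cancel_left _ two_pos]
      linarith
  have hmain := card_le_card_lapEigenvalues (starlikeTree a) 1 (2 - 1 / (N : ℝ))
    (weightedPullback c s) hinj fun t => by
      rw [sum_starlikeTree_adj a (fun p q => (weightedPullback c s t p - weightedPullback c s t q) ^ 2)
        (fun p q => by ring), Fintype.sum_option, one_mul, mul_div_cancel_left₀ _ two_ne_zero,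
        sub_nonpos, Fintype.sum_sigma, Fintype.sum_sigma]
      have hnone : weightedPullback c s t none = 0 := by simp [weightedPullback_apply, s]
      rw [hnone, zero_pow two_ne_zero, zero_add, Finset.mul_sum]
      refine Finset.sum_le_sum fun i _ => ?_
      -- Extension by 0 beyond the branch; `X` is shifted by one so that `X 0` is the value at the
      -- centre.
      let t' : ℕ → ℝ := fun m => if hm : m < (a i + 1) / 2 then t ⟨i, ⟨m, hm⟩⟩ else 0
      let X : ℕ → ℝ
        | 0 => 0
        | j + 1 => w j * t' (j / 2)
      have hX : ∀ j : Fin (a i), weightedPullback c s t (some ⟨i, j⟩) = X (j + 1) := by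
        intro j
        have : (j : ℕ) / 2 < (a i + 1) / 2 := by omega
        simp [weightedPullback_apply, X, s, c, t', this]
      have hP : ∀ j : Fin (a i), weightedPullback c s t (starlikeParent a ⟨i, j⟩) = X j := by
        intro j
        unfold starlikeParent
        split_ifs with h0
        · simp only at h0
          rw [h0, hnone]
        · dsimp only at h0 ⊢
          rw [hX]
          exact congrArg X (Nat.sub_add_cancel (Nat.pos_of_ne_zero h0))
      have hb := branch_form_le N t' X rfl
        (fun m => by simp [X, w])
        (fun m => by
          have h1 : (2 * m + 1) % 2 = 1 := by omega
          have h2 : (2 * m + 1) / 2 = m := by omega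
          simp [X, w, h1, h2])
        (by omega) (a i) (haN i) (fun m hm => dif_neg (by omega))
        (fun ho => by
          by_cases hi : i = l
          · exact hi ▸ hlN
          · exact absurd (he i hi) (Nat.not_even_iff_odd.mpr ho))
      simp only [hX, hP]
      rw [Fin.sum_univ_eq_sum_range (fun j => (X j - X (j + 1)) ^ 2),
        Fin.sum_univ_eq_sum_range (fun j => X (j + 1) ^ 2)]
      exact hb
  rw [card_half_branches hl he hN] at hmain
  simpa only [one_mul, sub_nonpos] using hmain

/-- The tree has a perfect matching. Vectors taking opposite values at matched vertices form an
`N`-dimensional space on which the form is at least twice the squared norm. -/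
theorem card_le_card_lapEigenvalues_starlikeTree_ge (hl : Odd (a l))
    (he : ∀ i, i ≠ l → Even (a i)) (hN : ∑ i, a i + 1 = 2 * N) :
    N ≤ (Finset.univ.filter fun p => 2 ≤ lapEigenvalues (starlikeTree a) p).card := by
  classical
  have hal : 0 < a l := hl.pos
  -- Classes are matching edges: the centre goes with index 0 of the odd branch, which continues
  -- with pairs (1,2), (3,4), …; the even branches use (0,1), (2,3), ….
  let c : Option (Σ i : Fin h, Fin (a i)) → Σ i : Fin h, Fin ((a i + 1) / 2)
    | none => ⟨l, ⟨0, by omega⟩⟩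
    | some v => ⟨v.1, ⟨if v.1 = l then (v.2 + 1) / 2 else v.2 / 2, by
        split_ifs with hi
        · have := v.2.2
          rw [← hi] at hl
          obtain ⟨m, hm⟩ := hl
          omega
        · omega⟩⟩
  let s : Option (Σ i : Fin h, Fin (a i)) → ℝ
    | none => -1
    | some v => (-1) ^ (v.2 : ℕ)
  let r : (Σ i : Fin h, Fin ((a i + 1) / 2)) → Option (Σ i : Fin h, Fin (a i)) :=
    fun i => some ⟨i.1, ⟨2 * i.2, by omega⟩⟩
  have hinj : Function.Injective (weightedPullback c s) := by
    refine weightedPullback_injective c s r ?_ ?_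
    · rintro ⟨i, m⟩
      simp only [c, r, Sigma.mk.injEq, heq_eq_eq, true_and, Fin.ext_iff]
      split_ifs <;> omega
    · rintro ⟨i, m⟩
      simp [s, r]
  have hm : ∀ p, ∃ q, (starlikeTree a).Adj p q ∧ c q = c p ∧ s q = - s p := by
    rintro (_ | ⟨i, j⟩)
    · refine ⟨some ⟨l, ⟨0, hal⟩⟩, ?_, ?_, ?_⟩
      · simp [starlikeTree_adj_none_some]
      · simp [c]
      · simp [s]
    · have hj := j.2
      have hup : ∀ hj' : (j : ℕ) + 1 < a i,
          ((if i = l then ((j : ℕ) + 1 + 1) / 2 else ((j : ℕ) + 1) / 2) =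
            if i = l then ((j : ℕ) + 1) / 2 else (j : ℕ) / 2) →
          ∃ q, (starlikeTree a).Adj (some ⟨i, j⟩) q ∧ c q = c (some ⟨i, j⟩) ∧
            s q = - s (some ⟨i, j⟩) := by
        intro hj' hc
        refine ⟨some ⟨i, ⟨j + 1, hj'⟩⟩, ?_, ?_, ?_⟩
        · simp [starlikeTree_adj_some_some]
        · simpa [c] using hc
        · simp [s, pow_succ]
      have hdown : ∀ hj' : 1 ≤ (j : ℕ),
          ((if i = l then ((j : ℕ) - 1 + 1) / 2 else ((j : ℕ) - 1) / 2) =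
            if i = l then ((j : ℕ) + 1) / 2 else (j : ℕ) / 2) →
          ∃ q, (starlikeTree a).Adj (some ⟨i, j⟩) q ∧ c q = c (some ⟨i, j⟩) ∧
            s q = - s (some ⟨i, j⟩) := by
        intro hj' hc
        refine ⟨some ⟨i, ⟨j - 1, by omega⟩⟩, ?_, ?_, ?_⟩
        · simp only [starlikeTree_adj_some_some, true_and]
          omega
        · simpa [c] using hc
        · obtain ⟨m, hm⟩ := Nat.exists_eq_add_of_le' hj'
          simp [s, hm, pow_succ]
      by_cases hi : i = l
      · subst hi
        obtain ⟨m, hm⟩ := hl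
        by_cases h0 : (j : ℕ) = 0
        · refine ⟨none, ?_, ?_, ?_⟩
          · rw [SimpleGraph.adj_comm]
            simp [starlikeTree_adj_none_some, h0]
          · simp [c, h0]
          · simp [s, h0]
        · by_cases h2 : (j : ℕ) % 2 = 0
          · exact hdown (by omega) (by simp; omega)
          · exact hup (by omega) (by simp; omega)
      · obtain ⟨m, hm⟩ := he i hi
        by_cases h2 : (j : ℕ) % 2 = 0
        · exact hup (by omega) (by simp [hi]; omega)
        · exact hdown (by omega) (by simp [hi]; omega)
  choose m hm using hm
  have hmain := card_le_card_lapEigenvalues (starlikeTree a) (-1) 2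
    (weightedPullback c s) hinj fun t => by
      have := two_mul_sum_sq_le_of_neighbor (starlikeTree a) m (fun p => (hm p).1)
        (weightedPullback c s t) fun p => by
          simp only [weightedPullback_apply, (hm p).2.1, (hm p).2.2]
          ring
      linarith
  rw [card_half_branches hl he hN] at hmain
  refine hmain.trans_eq (congrArg _ (Finset.filter_congr fun p _ => ?_))
  constructor <;> intro hp <;> linarith

theorem averageDegree_starlikeTree (hN : ∑ i, a i + 1 = 2 * N) :
    averageDegree (starlikeTree a) = 2 - 1 / (N : ℝ) := by
  classical
  have hN0 : (0 : ℝ) < N := by exact_mod_cast (by omega : 0 < N)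
  have hs : ∑ i, (a i : ℝ) = 2 * N - 1 := by
    rw [eq_sub_iff_add_eq]
    exact_mod_cast hN
  rw [averageDegree_eq, sum_degree_starlikeTree, card_starlikeTree_vertices, hN, hs]
  push_cast
  field_simp

/-- The Laplacian energy of a starlike tree with a single odd branch, which has less than half of
the vertices, is the sum of the distances of its Laplacian eigenvalues from `2`. -/
theorem laplacianEnergy_starlikeTree (hl : Odd (a l)) (he : ∀ i, i ≠ l → Even (a i))
    (hN : ∑ i, a i + 1 = 2 * N) (hlN : a l < N) :
    laplacianEnergy (starlikeTree a) = ∑ p, |lapEigenvalues (starlikeTree a) p - 2| := by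
  have hN0 : (0 : ℝ) < N := by exact_mod_cast (by omega : 0 < N)
  rw [laplacianEnergy, averageDegree_starlikeTree hN]
  refine sum_abs_sub_eq_of_card_le _ N ?_ ?_
    (card_le_card_lapEigenvalues_starlikeTree_le hl he hN hlN)
    (card_le_card_lapEigenvalues_starlikeTree_ge hl he hN)
  · have : 0 < 1 / (N : ℝ) := by positivity
    linarith
  · rw [card_starlikeTree_vertices, hN]

end Starlike

/-! ### Existence of the decomposition. -/

theorem exists_wDecomposition {V : Type*} [Fintype V] {n k : ℕ} (G : SimpleGraph V)
    (hn : Fintype.card V = n) (hk : 0 < k) (f g : Fin k → V) (r : V)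
    (hf : Function.Injective f) (hg : Function.Injective g) (hfg : ∀ i j, f i ≠ g j)
    (hrf : ∀ i, f i ≠ r) (hrg : ∀ i, g i ≠ r)
    (hff : ∀ i j, G.Adj (f i) (f j) ↔ (SimpleGraph.pathGraph k).Adj i j)
    (hgg : ∀ i j, G.Adj (g i) (g j) ↔ (SimpleGraph.pathGraph k).Adj i j)
    (hnfg : ∀ i j, ¬ G.Adj (f i) (g j))
    (hfb : ∀ i b, (∀ j, f j ≠ b) → (∀ j, g j ≠ b) → (G.Adj (f i) b ↔ b = r ∧ (i : ℕ) + 1 = k))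
    (hgb : ∀ i b, (∀ j, f j ≠ b) → (∀ j, g j ≠ b) → (G.Adj (g i) b ↔ b = r ∧ (i : ℕ) + 1 = k)) :
    ∃ d : WDecomposition n k G, d.Gstar = SimpleGraph.pathGraph k ∧
      d.y = canonicalVector k k ∧ d.iso (.inr (.inr d.root)) = r := by
  classical
  -- The complement of the two paths, with its induced edges, becomes the rooted graph.
  let B := {p : V // (∀ j, f j ≠ p) ∧ ∀ j, g j ≠ p}
  let F : Fin k ⊕ Fin k ⊕ B → V := Sum.elim f (Sum.elim g Subtype.val)
  have hF : Function.Bijective F := by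
    constructor
    · refine hf.sumElim (hg.sumElim Subtype.val_injective fun i b => b.2.2 i) ?_
      rintro i (j | b)
      · exact hfg i j
      · exact b.2.1 i
    · intro p
      by_cases h1 : ∃ i, f i = p
      · exact ⟨.inl h1.choose, h1.choose_spec⟩
      · by_cases h2 : ∃ i, g i = p
        · exact ⟨.inr (.inl h2.choose), h2.choose_spec⟩
        · push Not at h1 h2
          exact ⟨.inr (.inr ⟨p, h1, h2⟩), rfl⟩
  have hB : Fintype.card B = n - 2 * k := by
    have := Fintype.card_of_bijective hF
    simp only [Fintype.card_sum, Fintype.card_fin] at this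
    omega
  let eB : Fin (n - 2 * k) ≃ B := (Fintype.equivFinOfCardEq hB).symm
  let E : Fin k ⊕ Fin k ⊕ Fin (n - 2 * k) ≃ V :=
    ((Equiv.refl _).sumCongr ((Equiv.refl _).sumCongr eB)).trans (Equiv.ofBijective F hF)
  let r' : B := ⟨r, hrf, hrg⟩
  have hr : ∀ b, (eB b).1 = r ↔ b = eB.symm r' := fun b => by
    rw [Equiv.eq_symm_apply, Subtype.ext_iff]
  have h1 : ∀ i, E (.inl i) = f i := fun _ => rfl
  have h2 : ∀ i, E (.inr (.inl i)) = g i := fun _ => rfl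
  have h3 : ∀ b, E (.inr (.inr b)) = (eB b).1 := fun _ => rfl
  refine ⟨⟨hk, SimpleGraph.pathGraph k, G.comap fun b => (eB b).1, eB.symm r',
    canonicalVector k k, ⟨E, ?_⟩⟩, rfl, rfl, ?_⟩
  · rintro (i | i | b) (j | j | c)
    · rw [h1, h1, hff, twoCopyGraph_adj_inl_inl]
    · rw [h1, h2, twoCopyGraph_adj_inl_snd]
      exact iff_false_intro (hnfg i j)
    · rw [h1, h3, hfb i _ (eB c).2.1 (eB c).2.2, twoCopyGraph_adj_inl_rest,
        canonicalVector_eq_one_iff, hr]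
    · rw [h1, h2, twoCopyGraph_adj_snd_inl, G.adj_comm]
      exact iff_false_intro (hnfg j i)
    · rw [h2, h2, hgg, twoCopyGraph_adj_snd_snd]
    · rw [h2, h3, hgb i _ (eB c).2.1 (eB c).2.2, twoCopyGraph_adj_snd_rest,
        canonicalVector_eq_one_iff, hr]
    · rw [h1, h3, G.adj_comm, hfb j _ (eB b).2.1 (eB b).2.2, twoCopyGraph_adj_rest_inl,
        canonicalVector_eq_one_iff, hr]
    · rw [h2, h3, G.adj_comm, hgb j _ (eB b).2.1 (eB b).2.2, twoCopyGraph_adj_rest_snd,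
        canonicalVector_eq_one_iff, hr]
    · rw [h3, h3, twoCopyGraph_adj_rest_rest]
      rfl
  · change (eB (eB.symm r')).1 = r
    rw [Equiv.apply_symm_apply]

section Starlike

variable {h : ℕ} {a : Fin h → ℕ}

/-- The vertices of a branch of a starlike tree, listed towards the centre. -/
def branchVertex {k : ℕ} (i : Fin h) (hi : a i = k) (j : Fin k) :
    Option (Σ i : Fin h, Fin (a i)) :=
  some ⟨i, ⟨k - 1 - j, by omega⟩⟩

variable {k : ℕ} {i i' : Fin h} (hi : a i = k) (hi' : a i' = k)

theorem branchVertex_injective : Function.Injective (branchVertex (a := a) i hi) := by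
  intro j j' hj
  simp only [branchVertex, Option.some.injEq, Sigma.mk.injEq, heq_eq_eq, true_and,
    Fin.ext_iff] at hj
  omega

theorem branchVertex_ne_branchVertex (hne : i ≠ i') (j j' : Fin k) :
    branchVertex i hi j ≠ branchVertex i' hi' j' := by
  simp [branchVertex, hne]

theorem starlikeTree_adj_branchVertex (j j' : Fin k) :
    (starlikeTree a).Adj (branchVertex i hi j) (branchVertex i hi j') ↔
      (SimpleGraph.pathGraph k).Adj j j' := by
  simp only [branchVertex, starlikeTree_adj_some_some, SimpleGraph.pathGraph_adj, true_and]
  omega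

theorem not_starlikeTree_adj_branchVertex (hne : i ≠ i') (j j' : Fin k) :
    ¬ (starlikeTree a).Adj (branchVertex i hi j) (branchVertex i' hi' j') := by
  simp [branchVertex, starlikeTree_adj_some_some, hne]

theorem starlikeTree_adj_branchVertex_iff (j : Fin k) (b : Option (Σ i : Fin h, Fin (a i)))
    (hb : ∀ j, branchVertex i hi j ≠ b) :
    (starlikeTree a).Adj (branchVertex i hi j) b ↔ b = none ∧ (j : ℕ) + 1 = k := by
  rcases b with _ | ⟨l, m⟩
  · rw [SimpleGraph.adj_comm, branchVertex, starlikeTree_adj_none_some]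
    simp only [true_and]
    omega
  · rw [branchVertex, starlikeTree_adj_some_some]
    simp only [reduceCtorEq, false_and, iff_false]
    rintro ⟨hl, -⟩
    obtain rfl : i = l := hl
    have hm := m.2
    refine hb ⟨k - 1 - m, by omega⟩ ?_
    simp only [branchVertex, Option.some.injEq, Sigma.mk.injEq, heq_eq_eq, true_and, Fin.ext_iff]
    omega

theorem exists_wDecomposition_starlikeTree {n : ℕ} (hk : 0 < k) (hne : i ≠ i')
    (hi : a i = k) (hi' : a i' = k) (hn : ∑ i, a i + 1 = n) :
    ∃ d : WDecomposition n k (starlikeTree a), d.Gstar = SimpleGraph.pathGraph k ∧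
      d.y = canonicalVector k k ∧ d.iso (.inr (.inr d.root)) = none :=
  exists_wDecomposition (starlikeTree a) ((card_starlikeTree_vertices a).trans hn) hk
    (branchVertex i hi) (branchVertex i' hi') none
    (branchVertex_injective hi) (branchVertex_injective hi')
    (branchVertex_ne_branchVertex hi hi' hne) (by simp [branchVertex]) (by simp [branchVertex])
    (starlikeTree_adj_branchVertex hi) (starlikeTree_adj_branchVertex hi')
    (not_starlikeTree_adj_branchVertex hi hi' hne)
    (fun j b hb _ => starlikeTree_adj_branchVertex_iff hi j b hb)
    (fun j b _ hb => starlikeTree_adj_branchVertex_iff hi' j b hb)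

theorem le_encard_neighborSet_starlikeTree (ha : ∀ i, 1 ≤ a i) :
    (h : ℕ∞) ≤ ((starlikeTree a).neighborSet none).encard := by
  let g : Fin h → Option (Σ i : Fin h, Fin (a i)) := fun i => some ⟨i, ⟨0, ha i⟩⟩
  have hg : Function.Injective g := by
    intro i j hij
    simp only [g, Option.some.injEq, Sigma.mk.injEq] at hij
    exact hij.1
  calc (h : ℕ∞) = (Set.range g).encard := by
        rw [← Set.image_univ, hg.encard_image, Set.encard_univ]
        simp
    _ ≤ _ := Set.encard_le_encard (by
        rintro _ ⟨i, rfl⟩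
        exact (starlikeTree_adj_none_some a _).2 rfl)

end Starlike

/-! ### The main theorem. -/

theorem mainTheorem4 {V : Type*} [Fintype V] (n k : ℕ) (G : SimpleGraph V) (hG : MemS n k G) :
    (∃ d : WDecomposition n k G, d.IsStarlike) ∧
    ∀ d : WDecomposition n k G, d.IsStarlike →
      laplacianEnergy G = laplacianEnergy (d.opE (canonicalVector k 1)) := by
  obtain ⟨hcard, hk, h, hh, a, ha, heven, h0, h1, hodd, hlt, ⟨e⟩⟩ := hG
  have hsum : ∑ i, a i + 1 = n := by
    rw [← card_starlikeTree_vertices, ← hcard]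
    exact Fintype.card_congr e.toEquiv
  constructor
  · obtain ⟨d, hd1, hd2, hd3⟩ :=
      exists_wDecomposition_starlikeTree (by omega) (by simp) h0 h1 hsum
    refine ⟨⟨d.k_pos, d.Gstar, d.Gbreve, d.root, d.y, d.iso.trans e⟩, hd1, hd2, ?_⟩
    have hr : (d.iso.trans e) (.inr (.inr d.root)) = e none := congrArg e hd3
    change 2 < (G.neighborSet ((d.iso.trans e) (.inr (.inr d.root)))).encard
    have himg : e '' (starlikeTree a).neighborSet none ⊆ G.neighborSet (e none) := by
      rintro _ ⟨p, hp, rfl⟩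
      exact e.map_adj_iff.2 hp
    calc (2 : ℕ∞) < h := by exact_mod_cast hh
      _ ≤ _ := le_encard_neighborSet_starlikeTree ha
      _ = (e '' (starlikeTree a).neighborSet none).encard := (e.injective.encard_image _).symm
      _ ≤ _ := by rw [hr]; exact Set.encard_le_encard himg
  · rintro d ⟨hd1, hd2, -⟩
    set l : Fin h := ⟨h - 1, by omega⟩ with hl
    have he : ∀ i, i ≠ l → Even (a i) := fun i hi => heven i (by
      have := i.2
      rw [hl, ne_eq, Fin.ext_iff] at hi
      dsimp only at hi
      omega)
    obtain ⟨N, hN⟩ : ∃ N, ∑ i, a i + 1 = 2 * N := ⟨_, (two_mul_sum_half hodd he).symm⟩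
    have hnN : n = 2 * N := hsum.symm.trans hN
    have hlN : a l < N := by
      rw [hnN] at hlt
      push_cast at hlt
      exact_mod_cast (by linarith : (a l : ℝ) < N)
    have hN0 : (0 : ℝ) < N := by exact_mod_cast (by omega : 0 < N)
    have havg : averageDegree G = 2 - 1 / (N : ℝ) := by
      rw [← averageDegree_eq_of_iso e, averageDegree_starlikeTree hN]
    rw [laplacianEnergy_opE d hd1 hd2 (by
        rw [havg, hcard, hnN]
        push_cast
        field_simp
        ring),
      ← sum_abs_lapEigenvalues_sub_of_iso e, ← laplacianEnergy_starlikeTree hodd he hN hlN,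
      laplacianEnergy, laplacianEnergy, ← averageDegree_eq_of_iso e,
      sum_abs_lapEigenvalues_sub_of_iso e]
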